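/- Let $V$ be a finite-dimensional real inner product space and let $G = \{g_1, \dots, g_M\}$ be a finite group of order $M$ (with a fixed enumeration) acting on $V$ by linear isometries. For $v, w \in V$ write $v \sim w$ if $v = gw$ for some $g \in G$. Let $\Phi = (\phi_1, \dots, \phi_N)$ be a finite sequence in $V$. Define $\beta_\Phi : V \to \mathbb{R}^{M \times N}$ by letting the $j$-th column of $\beta_\Phi(v)$ be the vector $(\langle v, g_1 \phi_j\rangle, \dots, \langle v, g_M \phi_j\rangle)^\top$ with its entries sorted in decreasing order. Let $\alpha : \mathbb{R}^{M \times N} \to \mathbb{R}^D$ be linear and put $\gamma := \alpha \circ \beta_\Phi : V \to \mathbb{R}^D$. Suppose that $\gamma$ separates orbits, i.e. $\gamma(v) = \gamma(w)$ implies $v \sim w$ for all $v, w \in V$. Let $Z$ be a locally convex real topological vector space and let $f : V \to Z$ be continuous and $G$-invariant, i.e. $f(v) = f(w)$ whenever $v \sim w$. Then there exists a continuous map $g : \mathbb{R}^D \to Z$ such that $g(\mathbb{R}^D)$ is contained in the convex hull of $f(V)$ and $f = g \circ \gamma$. -/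

import Mathlib

namespace SortEmbedding

/-- Sorting a real vector of length `M` in a monotonically decreasing way
(Mathlib's `Tuple.sort` sorts increasingly, so the result is read backwards). -/
noncomputable def sortDecr {M : ℕ} (x : Fin M → ℝ) : Fin M → ℝ :=
  fun i => x (Tuple.sort x (Fin.rev i))

theorem sortDecr_antitone {M : ℕ} (x : Fin M → ℝ) : Antitone (sortDecr x) :=
  fun _ _ hij => Tuple.monotone_sort x (Fin.rev_le_rev.mpr hij)

/-- `sortDecr x` is a rearrangement of the entries of `x`. -/
theorem sortDecr_eq_comp_perm {M : ℕ} (x : Fin M → ℝ) :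
    ∃ σ : Equiv.Perm (Fin M), sortDecr x = x ∘ σ :=
  ⟨Fin.revPerm.trans (Tuple.sort x), rfl⟩

section

variable {G V : Type*} [Group G] [NormedAddCommGroup V] [InnerProductSpace ℝ V]

/-- `v ∼ w` if and only if `v = g w` for some `g` in the group. The unitary action is a group
homomorphism `ρ` into the group of linear isometric bijections of `V`. -/
def OrbitEquiv (ρ : G →* (V ≃ₗᵢ[ℝ] V)) (v w : V) : Prop :=
  ∃ g : G, v = ρ g w

/-- Invariance of a map under the action: it is constant on orbits. -/
def IsInvariant {W : Type*} (ρ : G →* (V ≃ₗᵢ[ℝ] V)) (h : V → W) : Prop :=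
  ∀ v w : V, OrbitEquiv ρ v w → h v = h w

/-- Orbit separation: points with the same image lie in the same orbit. -/
def SeparatesOrbits {W : Type*} (ρ : G →* (V ≃ₗᵢ[ℝ] V)) (h : V → W) : Prop :=
  ∀ v w : V, h v = h w → OrbitEquiv ρ v w

/-- The coorbit `(⟨v, g₁ φ⟩, …, ⟨v, g_M φ⟩)` for the enumeration `g₁, …, g_M` of the group
given by `e`. -/
noncomputable def coorbit {M : ℕ} (ρ : G →* (V ≃ₗᵢ[ℝ] V)) (e : Fin M ≃ G) (φ v : V) :
    Fin M → ℝ :=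
  fun i => inner ℝ v (ρ (e i) φ)

/-- The matrix whose `j`-th column is the decreasingly sorted coorbit of `v` with respect to
the `j`-th vector of the sequence `Φ`. -/
noncomputable def sortedCoorbits {M N : ℕ} (ρ : G →* (V ≃ₗᵢ[ℝ] V)) (e : Fin M ≃ G)
    (Φ : Fin N → V) (v : V) : Matrix (Fin M) (Fin N) ℝ :=
  Matrix.of fun i j => sortDecr (coorbit ρ e (Φ j) v) i

/-- The sorting based embedding `α ∘ β_Φ : V → ℝ^D`. -/
noncomputable def embedding {M N D : ℕ} (ρ : G →* (V ≃ₗᵢ[ℝ] V)) (e : Fin M ≃ G)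
    (Φ : Fin N → V) (α : Matrix (Fin M) (Fin N) ℝ →ₗ[ℝ] EuclideanSpace ℝ (Fin D)) :
    V → EuclideanSpace ℝ (Fin D) :=
  fun v => α (sortedCoorbits ρ e Φ v)

end

end SortEmbedding

/-! The map `γ` is continuous and positively homogeneous, and separating orbits makes it vanish only
at `0`, since the orbit of `0` is `{0}`. Compactness of the unit sphere then gives `m * ‖v‖ ≤ ‖γ v‖`
with `m > 0`, so `γ` is proper, hence closed. Thus `f` descends to a continuous map on the closed
set `γ(V)`, which Dugundji's theorem extends inside the convex hull. -/

/-- Dugundji's extension theorem: a continuous map from a nonempty closed subset of a metric space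
into a locally convex space extends continuously, with values in the convex hull of its image. -/
theorem ContinuousOn.exists_extension_mem_convexHull {X Z : Type*} [MetricSpace X]
    [AddCommGroup Z] [Module ℝ Z] [TopologicalSpace Z] [IsTopologicalAddGroup Z]
    [ContinuousSMul ℝ Z] [LocallyConvexSpace ℝ Z] {K : Set X} (hK : IsClosed K)
    (hne : K.Nonempty) {f : X → Z} (hf : ContinuousOn f K) :
    ∃ g : X → Z, Continuous g ∧ Set.EqOn g f K ∧ Set.range g ⊆ convexHull ℝ (f '' K) := by
  classical
  -- Any factor above 1 makes the set of nearly closest points nonempty. A near-closest `a` stays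
  -- admissible for nearby points, so constants are local selections, glued by a partition of unity.
  let t : (Kᶜ : Set X) → Set Z := fun x =>
    convexHull ℝ (f '' {a ∈ K | dist (x : X) a < 2 * Metric.infDist (x : X) K})
  have hpos : ∀ x : (Kᶜ : Set X), 0 < Metric.infDist (x : X) K := fun x =>
    (hK.notMem_iff_infDist_pos hne).1 x.2
  obtain ⟨h, hh⟩ := exists_continuous_forall_mem_convex_of_local_const (t := t)
    (fun x => convex_convexHull ℝ _) (fun x => by
      obtain ⟨a, haK, ha⟩ := (Metric.infDist_lt_iff hne).1
        (show Metric.infDist (x : X) K < 2 * Metric.infDist (x : X) K by linarith [hpos x])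
      have hop : IsOpen {y : (Kᶜ : Set X) | dist (y : X) a < 2 * Metric.infDist (y : X) K} :=
        isOpen_lt (by fun_prop)
          (continuous_const.mul ((Metric.continuous_infDist_pt K).comp continuous_subtype_val))
      refine ⟨f a, ?_⟩
      filter_upwards [hop.mem_nhds ha] with y hy
      exact subset_convexHull ℝ _ ⟨a, ⟨haK, hy⟩, rfl⟩)
  let g : X → Z := fun x => if hx : x ∈ K then f x else h ⟨x, hx⟩
  have gK : ∀ x ∈ K, g x = f x := fun x hx => dif_pos hx
  have gKc : ∀ x (hx : x ∉ K), g x = h ⟨x, hx⟩ := fun x hx => dif_neg hx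
  refine ⟨g, continuous_iff_continuousAt.2 fun x => ?_, gK, ?_⟩
  · by_cases hx : x ∈ K
    · rw [ContinuousAt, gK x hx]
      refine (LocallyConvexSpace.convex_basis (𝕜 := ℝ) (f x)).tendsto_right_iff.2 ?_
      rintro W ⟨hW, hWc⟩
      obtain ⟨δ, hδ, hδW⟩ := Metric.mem_nhdsWithin_iff.1 (hf x hx hW)
      -- One third, because `dist a x < 2 * infDist y K + dist y x ≤ 3 * dist y x`.
      filter_upwards [Metric.ball_mem_nhds x (show 0 < δ / 3 by positivity)] with y hy
      rw [Metric.mem_ball] at hy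
      by_cases hyK : y ∈ K
      · rw [gK y hyK]
        exact hδW ⟨Metric.mem_ball.2 (by linarith), hyK⟩
      · rw [gKc y hyK]
        refine convexHull_min ?_ hWc (hh ⟨y, hyK⟩)
        rintro _ ⟨a, ⟨haK, ha⟩, rfl⟩
        refine hδW ⟨Metric.mem_ball.2 ?_, haK⟩
        have h1 : Metric.infDist y K ≤ dist y x := Metric.infDist_le_dist_of_mem hx
        have h2 : dist a x ≤ dist y a + dist y x := by
          simpa only [dist_comm a y] using dist_triangle a y x
        change dist y a < _ at ha
        change dist y a < 2 * Metric.infDist y K at ha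
        linarith
    · have : ContinuousOn g Kᶜ := by
        rw [continuousOn_iff_continuous_domRestrict]
        convert h.continuous using 1
        ext y
        exact gKc y y.2
      exact this.continuousAt (hK.isOpen_compl.mem_nhds hx)
  · rintro _ ⟨x, rfl⟩
    by_cases hx : x ∈ K
    · rw [gK x hx]
      exact subset_convexHull ℝ _ ⟨x, hx, rfl⟩
    · rw [gKc x hx]
      exact convexHull_mono (Set.image_mono fun a ha => ha.1) (hh ⟨x, hx⟩)

/-- A continuous map out of `V` that is constant on the fibres of a closed continuous map `γ` into a
metric space factors continuously through `γ`. -/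
theorem IsClosedMap.exists_factorization_mem_convexHull {V X Z : Type*} [TopologicalSpace V]
    [Nonempty V] [MetricSpace X]
    [AddCommGroup Z] [Module ℝ Z] [TopologicalSpace Z] [IsTopologicalAddGroup Z]
    [ContinuousSMul ℝ Z] [LocallyConvexSpace ℝ Z] {γ : V → X} (hγ : IsClosedMap γ)
    {f : V → Z} (hf : Continuous f) (hfγ : ∀ v w, γ v = γ w → f v = f w) :
    ∃ g : X → Z, Continuous g ∧ Set.range g ⊆ convexHull ℝ (Set.range f) ∧ f = g ∘ γ := by
  let k : X → Z := f ∘ Function.invFun γ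
  have hk : ∀ v, k (γ v) = f v := fun v => hfγ _ _ (Function.invFun_eq ⟨v, rfl⟩)
  have hkc : ContinuousOn k (Set.range γ) := by
    -- Within the range, `k ⁻¹' C` is `γ '' (f ⁻¹' C)`, closed because `γ` is a closed map.
    refine continuousOn_iff_isClosed.2 fun C hC => ⟨γ '' (f ⁻¹' C), hγ _ (hC.preimage hf), ?_⟩
    ext y
    constructor
    · rintro ⟨hy, v, rfl⟩
      exact ⟨⟨v, by simpa [hk] using hy, rfl⟩, v, rfl⟩
    · rintro ⟨⟨v, hv, rfl⟩, -⟩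
      exact ⟨by simpa [hk] using hv, v, rfl⟩
  obtain ⟨g, hg, hgk, hgr⟩ :=
    hkc.exists_extension_mem_convexHull hγ.isClosed_range (Set.range_nonempty γ)
  refine ⟨g, hg, ?_, funext fun v => ?_⟩
  · rwa [← Set.range_comp, show k ∘ γ = f from funext hk] at hgr
  · rw [Function.comp_apply, hgk ⟨v, rfl⟩, hk]

/-- A continuous positively homogeneous map on a finite-dimensional space that vanishes only at the
origin is a closed map. -/
theorem Continuous.isClosedMap_of_posHomogeneous {V E : Type*} [NormedAddCommGroup V]
    [NormedSpace ℝ V] [FiniteDimensional ℝ V] [NormedAddCommGroup E] [NormedSpace ℝ E]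
    [ProperSpace E] {γ : V → E} (hγ : Continuous γ)
    (hom : ∀ (c : ℝ) v, 0 ≤ c → γ (c • v) = c • γ v) (hz : ∀ v, γ v = 0 → v = 0) :
    IsClosedMap γ := by
  have := FiniteDimensional.proper_real V
  obtain ⟨m, hm, hmv⟩ : ∃ m : ℝ, 0 < m ∧ ∀ v, m * ‖v‖ ≤ ‖γ v‖ := by
    obtain ⟨m, hm, hmu⟩ : ∃ m : ℝ, 0 < m ∧ ∀ u ∈ Metric.sphere (0 : V) 1, m ≤ ‖γ u‖ := by
      -- This form also covers the empty sphere of a trivial `V`.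
      refine (isCompact_sphere (0 : V) 1).exists_forall_le' hγ.norm.continuousOn fun u hu => ?_
      refine norm_pos_iff.2 fun h => ?_
      simp [hz u h] at hu
    refine ⟨m, hm, fun v => ?_⟩
    rcases eq_or_ne v 0 with rfl | hv
    · simp
    · have hv' : 0 < ‖v‖ := norm_pos_iff.2 hv
      have hu := hmu (‖v‖⁻¹ • v) (by simp [norm_smul, hv'.ne'])
      rw [hom _ _ (by positivity), norm_smul, norm_inv, norm_norm] at hu
      rwa [inv_mul_eq_div, le_div_iff₀ hv'] at hu
  refine (isProperMap_iff_tendsto_cocompact.2 ⟨hγ, ?_⟩).isClosedMap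
  rw [← Metric.cobounded_eq_cocompact (α := E), ← tendsto_norm_atTop_iff_cobounded]
  exact Filter.tendsto_atTop_mono hmv (tendsto_norm_cocompact_atTop.const_mul_atTop hm)

namespace SortEmbedding

/-- With ties the sorting permutation is not unique, but the sorted vector is. -/
theorem sortDecr_eq_comp_of_antitone {M : ℕ} {x : Fin M → ℝ} {σ : Equiv.Perm (Fin M)}
    (h : Antitone (x ∘ σ)) : sortDecr x = x ∘ σ := by
  have hσ : Monotone (x ∘ (Fin.revPerm.trans σ : Equiv.Perm (Fin M))) :=
    fun _ _ hij => h (Fin.rev_le_rev.2 hij)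
  have := Tuple.unique_monotone (Tuple.monotone_sort x) hσ
  funext i
  simpa [sortDecr] using congrFun this (Fin.rev i)

/-- The closed chambers `S σ` form a finite cover, and on each one sorting is a fixed coordinate
permutation. -/
theorem continuous_sortDecr {M : ℕ} : Continuous (sortDecr : (Fin M → ℝ) → Fin M → ℝ) := by
  let S : Equiv.Perm (Fin M) → Set (Fin M → ℝ) := fun σ => {x | Antitone (x ∘ σ)}
  refine (locallyFinite_of_finite S).continuous ?_ (fun σ => ?_) fun σ => ?_
  · refine Set.eq_univ_of_forall fun x => Set.mem_iUnion.2 ?_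
    obtain ⟨σ, hσ⟩ := sortDecr_eq_comp_perm x
    exact ⟨σ, show Antitone (x ∘ σ) from hσ ▸ sortDecr_antitone x⟩
  · have : S σ = ⋂ (i) (j) (_ : i ≤ j), {x | x (σ j) ≤ x (σ i)} := by
      ext x
      simp [S, Antitone]
    rw [this]
    exact isClosed_iInter fun i => isClosed_iInter fun j => isClosed_iInter fun _ =>
      isClosed_le (continuous_apply _) (continuous_apply _)
  · have hc : Continuous fun x : Fin M → ℝ => x ∘ σ := by fun_prop
    exact hc.continuousOn.congr fun x hx => sortDecr_eq_comp_of_antitone hx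

theorem sortDecr_smul {M : ℕ} {c : ℝ} (hc : 0 ≤ c) (x : Fin M → ℝ) :
    sortDecr (c • x) = c • sortDecr x := by
  obtain ⟨σ, hσ⟩ := sortDecr_eq_comp_perm x
  have h : Antitone (x ∘ σ) := hσ ▸ sortDecr_antitone x
  rw [hσ]
  exact sortDecr_eq_comp_of_antitone fun i j hij => mul_le_mul_of_nonneg_left (h hij) hc

section

variable {G V : Type*} [Group G] [NormedAddCommGroup V] [InnerProductSpace ℝ V] {M N D : ℕ}
  (ρ : G →* (V ≃ₗᵢ[ℝ] V)) (e : Fin M ≃ G) (Φ : Fin N → V)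

theorem continuous_sortedCoorbits : Continuous (sortedCoorbits ρ e Φ) := by
  refine continuous_matrix fun i j => ?_
  have h : Continuous (coorbit ρ e (Φ j)) := continuous_pi fun i => by
    unfold coorbit
    fun_prop
  exact (continuous_apply i).comp (continuous_sortDecr.comp h)

theorem sortedCoorbits_smul {c : ℝ} (hc : 0 ≤ c) (v : V) :
    sortedCoorbits ρ e Φ (c • v) = c • sortedCoorbits ρ e Φ v := by
  ext i j
  have h : coorbit ρ e (Φ j) (c • v) = c • coorbit ρ e (Φ j) v := by
    ext i
    simp [coorbit, real_inner_smul_left]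
  simp [sortedCoorbits, h, sortDecr_smul hc]

variable (α : Matrix (Fin M) (Fin N) ℝ →ₗ[ℝ] EuclideanSpace ℝ (Fin D))

theorem continuous_embedding : Continuous (embedding ρ e Φ α) :=
  α.continuous_of_finiteDimensional.comp (continuous_sortedCoorbits ρ e Φ)

theorem embedding_smul {c : ℝ} (hc : 0 ≤ c) (v : V) :
    embedding ρ e Φ α (c • v) = c • embedding ρ e Φ α v := by
  simp [embedding, sortedCoorbits_smul ρ e Φ hc]

variable {ρ e Φ α}

theorem SeparatesOrbits.eq_zero_of_embedding_eq_zero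
    (hγ : SeparatesOrbits ρ (embedding ρ e Φ α)) {v : V} (hv : embedding ρ e Φ α v = 0) :
    v = 0 := by
  have h0 : embedding ρ e Φ α 0 = 0 := by simpa using embedding_smul ρ e Φ α le_rfl (0 : V)
  obtain ⟨g, hg⟩ := hγ v 0 (hv.trans h0.symm)
  simpa using hg

end

end SortEmbedding

theorem theorem1p3 {G V Z : Type*} [Group G]
    [NormedAddCommGroup V] [InnerProductSpace ℝ V] [FiniteDimensional ℝ V]
    [AddCommGroup Z] [Module ℝ Z] [TopologicalSpace Z] [IsTopologicalAddGroup Z]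
    [ContinuousSMul ℝ Z] [LocallyConvexSpace ℝ Z]
    {M N D : ℕ} (ρ : G →* (V ≃ₗᵢ[ℝ] V)) (e : Fin M ≃ G) (Φ : Fin N → V)
    (α : Matrix (Fin M) (Fin N) ℝ →ₗ[ℝ] EuclideanSpace ℝ (Fin D))
    (hγ : SortEmbedding.SeparatesOrbits ρ (SortEmbedding.embedding ρ e Φ α))
    (f : V → Z) (hf : SortEmbedding.IsInvariant ρ f) (hfc : Continuous f) :
    ∃ g : EuclideanSpace ℝ (Fin D) → Z,
      Continuous g ∧ Set.range g ⊆ convexHull ℝ (Set.range f) ∧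
        f = g ∘ SortEmbedding.embedding ρ e Φ α := by

  exact ((SortEmbedding.continuous_embedding ρ e Φ α).isClosedMap_of_posHomogeneous
    (fun _ v hc => SortEmbedding.embedding_smul ρ e Φ α hc v)
    fun _ => hγ.eq_zero_of_embedding_eq_zero).exists_factorization_mem_convexHull hfc
      fun v w h => hf v w (hγ v w h)
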